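/- Conventions. For sets $E,F$ of positive integers, $E<F$ means $\max E<\min F$, and $n\le E$ means $n\le\min E$ (both are true when one of the sets is empty). For every countable limit ordinal $\eta$ fix any strictly increasing sequence $(\eta_n)_{n\ge 1}$ of ordinals with supremum $\eta$, and define the Schreier families of finite sets of positive integers by $\mathcal S_0=\{E:|E|\le 1\}$; $\mathcal S_{\eta+1}$ is the family of all unions $E_1\cup\dots\cup E_k$ $(k\ge 0)$ of nonempty sets $E_1<\dots<E_k$ in $\mathcal S_\eta$ with $k\le\min E_1$; and $\mathcal S_\eta=\{E: \exists n\ge 1,\ n\le E \text{ and } E\in\mathcal S_{\eta_n}\}$ for limit $\eta<\omega_1$. A basic sequence $(x_i)$ in a Banach space is an $\ell_1^{\eta}$ spreading model if there are $c,C>0$ such that $c^{-1}\sum_{i\in E}|a_i|\le\|\sum_{i\in E}a_ix_i\|\le C\sum_{i\in E}|a_i|$ for all $E\in\mathcal S_\eta$ and all scalars $(a_i)_{i\in E}$; it is a $c_0^{\eta}$ spreading model if the same holds with $\max_{i\in E}|a_i|$ in place of $\sum_{i\in E}|a_i|$. Let $X$ be a (real or complex) Banach space with a Schauder basis $(e_i)$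 and let $t\ge1$. Then $X$ is $t$-$\mathcal S_\eta$ distortable if there is an equivalent norm $|\cdot|$ on $X$ such that for every normalized block sequence $(x_i)$ of $(e_i)$ there are $E\in\mathcal S_\eta$ and $x,y\in\operatorname{span}\{x_i:i\in E\}$ with $\|x\|=\|y\|=1$ and $|x|/|y|>t$. Let $D_t(X)$ be the least $\eta<\omega_1$ such that $X$ is $t$-$\mathcal S_\eta$ distortable, and $D_t(X)=\omega_1$ if there is no such $\eta$. Proposition. Let $X$ be a Banach space with a Schauder basis and let $0\le\xi<\omega_1$ be such that $X$ contains an $\ell_1^{\omega^\xi}$ or a $c_0^{\omega^\xi}$ spreading model. Then $D_{1+\varepsilon}(X)>\omega^\xi$ for every $\varepsilon>0$. -/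

import Mathlib

open scoped Ordinal

noncomputable section

/-! ### Schreier families

Sequences are indexed by `ℕ = {0, 1, 2, …}`, so a set `{n₁ < n₂ < …}` of positive integers is
represented by `{n₁ - 1 < n₂ - 1 < …}`.  Consequently the classical admissibility condition
`|E| ≤ min E` reads `|E| ≤ min E + 1`. -/

/-- The first Schreier family `{E : |E| ≤ min E}` (written for indices starting at `0`; the empty
set belongs to it). -/
def schreierOne : Set (Finset ℕ) :=
  {E | ∀ i ∈ E, E.card ≤ i + 1}

/-- The convolution `ℱ[𝒢]`: all unions `G₀ ∪ ⋯ ∪ G_{n-1}` of nonempty sets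
`G₀ < ⋯ < G_{n-1}` in `𝒢` such that `{min G₀, …, min G_{n-1}} ∈ ℱ`. -/
def familyBracket (ℱ 𝒢 : Set (Finset ℕ)) : Set (Finset ℕ) :=
  {E | ∃ (n : ℕ) (G : Fin n → Finset ℕ) (hG : ∀ i, (G i).Nonempty),
    (∀ i, G i ∈ 𝒢) ∧
    (∀ i j, i < j → ∀ a ∈ G i, ∀ b ∈ G j, a < b) ∧
    Finset.univ.image (fun i => (G i).min' (hG i)) ∈ ℱ ∧
    E = Finset.univ.biUnion G}

/-- `φ` assigns to every countable limit ordinal `ξ` a strictly increasing sequence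
`φ ξ 0 < φ ξ 1 < ⋯` of ordinals with supremum `ξ`. -/
def IsLadder (φ : Ordinal.{0} → ℕ → Ordinal.{0}) : Prop :=
  ∀ ξ : Ordinal.{0}, ξ < ω₁ → Order.IsSuccLimit ξ →
    StrictMono (φ ξ) ∧ IsLUB (Set.range (φ ξ)) ξ

/-- The transfinite Schreier family `𝒮_ξ`, built with the sequences `φ` at limit ordinals:
`𝒮_0` consists of the sets with at most one element, `𝒮_{ξ+1} = 𝒮_1[𝒮_ξ]`, and for a limit
ordinal `ξ`, `𝒮_ξ = {E : ∃ n ≤ E, E ∈ 𝒮_{φ ξ n}}`. -/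
def schreier (φ : Ordinal.{0} → ℕ → Ordinal.{0}) (ξ : Ordinal.{0}) : Set (Finset ℕ) :=
  Ordinal.limitRecOn ξ
    {E | E.card ≤ 1}
    (fun _ S => familyBracket schreierOne S)
    (fun η _ S => {E | ∃ (n : ℕ) (h : φ η n < η), (∀ i ∈ E, n ≤ i) ∧ E ∈ S (φ η n) h})

section Banach

variable {𝕜 : Type*} [RCLike 𝕜] {X : Type*} [NormedAddCommGroup X] [NormedSpace 𝕜 X]

/-! ### Basic sequences and spreading models -/

variable (𝕜) in
/-- `x` is a basic sequence: a Schauder basis of its closed linear span. -/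
def IsBasicSequence (x : ℕ → X) : Prop :=
  ∃ b : SchauderBasis 𝕜 (Submodule.span 𝕜 (Set.range x)).topologicalClosure,
    ∀ i, ((b i : (Submodule.span 𝕜 (Set.range x)).topologicalClosure) : X) = x i

variable (𝕜) in
/-- `x` is a `K`-`ℓ₁^ℱ` spreading model. -/
def IsEllOneSpreadingModel (K : ℝ) (ℱ : Set (Finset ℕ)) (x : ℕ → X) : Prop :=
  IsBasicSequence 𝕜 x ∧ ∃ c C : ℝ, 0 < c ∧ 0 < C ∧ c * C ≤ K ∧
    ∀ E ∈ ℱ, ∀ a : ℕ → 𝕜,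
      c⁻¹ * ∑ i ∈ E, ‖a i‖ ≤ ‖∑ i ∈ E, a i • x i‖ ∧
      ‖∑ i ∈ E, a i • x i‖ ≤ C * ∑ i ∈ E, ‖a i‖

variable (𝕜) in
/-- `x` is a `K`-`c₀^ℱ` spreading model; `E.sup (fun i => ‖a i‖₊)` is `max_{i ∈ E} |a_i|`. -/
def IsCZeroSpreadingModel (K : ℝ) (ℱ : Set (Finset ℕ)) (x : ℕ → X) : Prop :=
  IsBasicSequence 𝕜 x ∧ ∃ c C : ℝ, 0 < c ∧ 0 < C ∧ c * C ≤ K ∧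
    ∀ E ∈ ℱ, ∀ a : ℕ → 𝕜,
      c⁻¹ * ((E.sup (fun i => ‖a i‖₊) : NNReal) : ℝ) ≤ ‖∑ i ∈ E, a i • x i‖ ∧
      ‖∑ i ∈ E, a i • x i‖ ≤ C * ((E.sup (fun i => ‖a i‖₊) : NNReal) : ℝ)

variable (𝕜 X) in
/-- `X` contains an `ℓ₁^ℱ` spreading model (with some constant `K ≥ 1`). -/
def ContainsEllOneSpreadingModel (ℱ : Set (Finset ℕ)) : Prop :=
  ∃ K : ℝ, 1 ≤ K ∧ ∃ x : ℕ → X, IsEllOneSpreadingModel 𝕜 K ℱ x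

variable (𝕜 X) in
/-- `X` contains a `c₀^ℱ` spreading model (with some constant `K ≥ 1`). -/
def ContainsCZeroSpreadingModel (ℱ : Set (Finset ℕ)) : Prop :=
  ∃ K : ℝ, 1 ≤ K ∧ ∃ x : ℕ → X, IsCZeroSpreadingModel 𝕜 K ℱ x

/-! ### Distortion -/

/-- `p` is a norm on `X` equivalent to the given norm. -/
def IsEquivalentNorm (p : Seminorm 𝕜 X) : Prop :=
  ∃ a b : ℝ, 0 < a ∧ 0 < b ∧ ∀ x : X, a * ‖x‖ ≤ p x ∧ p x ≤ b * ‖x‖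

/-- The support of `x` with respect to the basis `e`. -/
def basisSupport (e : SchauderBasis 𝕜 X) (x : X) : Set ℕ :=
  {i | e.coord i x ≠ 0}

/-- `x` is a normalized block sequence of the basis `e`: the vectors have norm `1` and finite
supports, and `supp x₀ < supp x₁ < ⋯`. -/
def IsNormalizedBlockSequence (e : SchauderBasis 𝕜 X) (x : ℕ → X) : Prop :=
  (∀ n, ‖x n‖ = 1) ∧ (∀ n, (basisSupport e (x n)).Finite) ∧
    ∀ n, ∀ i ∈ basisSupport e (x n), ∀ j ∈ basisSupport e (x (n + 1)), i < j

/-- The equivalent norm `p` is a `t`-`ℱ` distortion of `X` (with respect to the basis `e`). -/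
def IsDistortion (e : SchauderBasis 𝕜 X) (t : ℝ) (ℱ : Set (Finset ℕ)) (p : Seminorm 𝕜 X) :
    Prop :=
  IsEquivalentNorm p ∧ ∀ x : ℕ → X, IsNormalizedBlockSequence e x →
    ∃ E ∈ ℱ, ∃ u ∈ Submodule.span 𝕜 (x '' (E : Set ℕ)),
      ∃ v ∈ Submodule.span 𝕜 (x '' (E : Set ℕ)),
        ‖u‖ = 1 ∧ ‖v‖ = 1 ∧ t < p u / p v

/-- `X` with the basis `e` is `t`-`ℱ` distortable. -/
def IsDistortable (e : SchauderBasis 𝕜 X) (t : ℝ) (ℱ : Set (Finset ℕ)) : Prop :=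
  ∃ p : Seminorm 𝕜 X, IsDistortion e t ℱ p

open scoped Classical in
/-- The distortion index `D_t(X)`: the least countable ordinal `ξ` such that `X` is
`t`-`𝒮_ξ` distortable, and `ω₁` if there is none. -/
def distortionIndex (φ : Ordinal.{0} → ℕ → Ordinal.{0}) (e : SchauderBasis 𝕜 X) (t : ℝ) :
    Ordinal.{0} :=
  if {ξ : Ordinal.{0} | ξ < ω₁ ∧ IsDistortable e t (schreier φ ξ)}.Nonempty then
    sInf {ξ : Ordinal.{0} | ξ < ω₁ ∧ IsDistortable e t (schreier φ ξ)}
  else ω₁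

end Banach

end

/-! ### Combinatorics of the Schreier families -/

/-! This is James's non-distortion argument for `ℓ₁` and `c₀`, run along the family `𝒮 = 𝒮_{ω^ξ}`.
Let `N` be the `ℓ₁` or `c₀` norm of coefficients. Blocks with `N`-norm one reproduce `N`, so an
`N`-estimate on `𝒮` survives passing to such blocks, provided unions of their supports along members
of `𝒮` stay in `𝒮`.

That closure comes from the additive indecomposability of `ω^ξ`. A set lies in `𝒮` exactly when it
lies in some `𝓕 n` with `n` at most its minimum, and sparse unions of members of `𝓕 n` along a
member of `𝓕 m` lie in a single `𝓕 k` (`exists_isBlockClosed_schreier`). A diagonal choice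
(`IsBlockClosed.exists_isBlocking`) then produces blockings on which any seminorm comparable to `N`
is almost a multiple of `N` (`exists_isBlocking_isEstimate_ellOne`,
`exists_isBlocking_isEstimate_cZero`).

Differences of terms and a gliding hump replace the spreading model by a block sequence of the
basis. Stabilizing the norm and then the new norm `p` makes `p / ‖·‖` almost constant on each span
along a member of `𝒮`. For `η ≤ ω^ξ`, far out members of `𝒮_η` lie in `𝒮`, so a shift of the block
sequence excludes every such `η`. -/

theorem mem_familyBracket_schreierOne {𝒢 : Set (Finset ℕ)} {E : Finset ℕ} :
    E ∈ familyBracket schreierOne 𝒢 ↔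
      ∃ (n : ℕ) (G : Fin n → Finset ℕ), (∀ i, (G i).Nonempty) ∧ (∀ i, G i ∈ 𝒢) ∧
        (∀ i j, i < j → ∀ a ∈ G i, ∀ b ∈ G j, a < b) ∧ (∀ i, ∀ a ∈ G i, n ≤ a + 1) ∧
        E = Finset.univ.biUnion G := by
  have card_image : ∀ (n : ℕ) (G : Fin n → Finset ℕ) (hG : ∀ i, (G i).Nonempty),
      (∀ i j, i < j → ∀ a ∈ G i, ∀ b ∈ G j, a < b) →
      (Finset.univ.image (fun i => (G i).min' (hG i))).card = n := by
    intro n G hG h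
    rw [Finset.card_image_of_injective, Finset.card_univ, Fintype.card_fin]
    have : StrictMono fun i => (G i).min' (hG i) := fun i j hij =>
      h i j hij _ (Finset.min'_mem _ _) _ (Finset.min'_mem _ _)
    exact this.injective
  constructor
  · rintro ⟨n, G, hG, hmem, hlt, hS, rfl⟩
    refine ⟨n, G, hG, hmem, hlt, fun i a ha => ?_, rfl⟩
    have h := hS _ (Finset.mem_image_of_mem _ (Finset.mem_univ i))
    rw [card_image n G hG hlt] at h
    have := Finset.min'_le _ _ ha
    omega
  · rintro ⟨n, G, hG, hmem, hlt, hS, rfl⟩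
    refine ⟨n, G, hG, hmem, hlt, fun a ha => ?_, rfl⟩
    rw [card_image n G hG hlt]
    obtain ⟨i, -, rfl⟩ := Finset.mem_image.1 ha
    exact hS i _ (Finset.min'_mem _ _)

variable {φ : Ordinal.{0} → ℕ → Ordinal.{0}}

theorem mem_schreier_zero {E : Finset ℕ} : E ∈ schreier φ 0 ↔ E.card ≤ 1 := by
  rw [schreier, Ordinal.limitRecOn_zero]; rfl

theorem schreier_add_one (α : Ordinal.{0}) :
    schreier φ (α + 1) = familyBracket schreierOne (schreier φ α) := by
  rw [schreier, Ordinal.limitRecOn_add_one]; rfl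

theorem IsLadder.lt (hφ : IsLadder φ) {η : Ordinal.{0}} (h : η < ω₁) (hl : Order.IsSuccLimit η)
    (n : ℕ) : φ η n < η :=
  ((hφ η h hl).1 n.lt_succ_self).trans_le ((hφ η h hl).2.1 ⟨n + 1, rfl⟩)

theorem IsLadder.exists_lt (hφ : IsLadder φ) {η α : Ordinal.{0}} (h : η < ω₁)
    (hl : Order.IsSuccLimit η) (hα : α < η) : ∃ n, α < φ η n := by
  obtain ⟨_, ⟨n, rfl⟩, hn⟩ := (lt_isLUB_iff (hφ η h hl).2).1 hα
  exact ⟨n, hn⟩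

theorem mem_schreier_limit (hφ : IsLadder φ) {η : Ordinal.{0}} (h : η < ω₁)
    (hl : Order.IsSuccLimit η) {E : Finset ℕ} :
    E ∈ schreier φ η ↔ ∃ n, (∀ i ∈ E, n ≤ i) ∧ E ∈ schreier φ (φ η n) := by
  rw [schreier, Ordinal.limitRecOn_limit _ _ _ _ hl]
  constructor
  · rintro ⟨n, hn, h1, h2⟩
    exact ⟨n, h1, h2⟩
  · rintro ⟨n, h1, h2⟩
    exact ⟨n, hφ.lt h hl n, h1, h2⟩

theorem schreier_subset_add_one {α : Ordinal.{0}} {E : Finset ℕ} (hE : E ∈ schreier φ α) :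
    E ∈ schreier φ (α + 1) := by
  rw [schreier_add_one, mem_familyBracket_schreierOne]
  rcases E.eq_empty_or_nonempty with rfl | hne
  · exact ⟨0, Fin.elim0, fun i => i.elim0, fun i => i.elim0, fun i => i.elim0, fun i => i.elim0,
      by simp⟩
  · refine ⟨1, fun _ => E, fun _ => hne, fun _ => hE, fun i j hij => ?_, fun _ a _ => by omega, ?_⟩
    · omega
    · ext; simp

@[elab_as_elim]
theorem induction_lt_omega1 {P : (α : Ordinal.{0}) → α < ω₁ → Prop} {α : Ordinal.{0}} (hα : α < ω₁)
    (zero : ∀ h, P 0 h)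
    (add_one : ∀ α h h', P α h → P (α + 1) h')
    (limit : ∀ η h, Order.IsSuccLimit η → (∀ α (h' : α < η), P α (h'.trans h)) → P η h) :
    P α hα := by
  induction α using Ordinal.limitRecOn with
  | zero => exact zero hα
  | add_one α ih => exact add_one α _ hα (ih ((lt_add_one α).trans hα))
  | limit η hl ih => exact limit η hα hl fun α h => ih α h (h.trans hα)

/-- A strictly increasing map only moves points to the right, so every admissibility condition
persists. This covers both subsequences and shifts. -/
theorem schreier_image (hφ : IsLadder φ) {α : Ordinal.{0}} (hα : α < ω₁) :
    ∀ {f : ℕ → ℕ}, StrictMono f → ∀ E ∈ schreier φ α, E.image f ∈ schreier φ α := by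
  intro f hf
  induction hα using induction_lt_omega1 with
  | zero _ =>
    intro E hE
    rw [mem_schreier_zero] at hE ⊢
    exact Finset.card_image_le.trans hE
  | add_one α h h' ih =>
    intro E hE
    rw [schreier_add_one, mem_familyBracket_schreierOne] at hE ⊢
    obtain ⟨n, G, h1, h2, h3, h4, rfl⟩ := hE
    refine ⟨n, fun i => (G i).image f, fun i => (h1 i).image f, fun i => ih _ (h2 i), ?_, ?_, ?_⟩
    · intro i j hij a ha b hb
      obtain ⟨a', ha', rfl⟩ := Finset.mem_image.1 ha
      obtain ⟨b', hb', rfl⟩ := Finset.mem_image.1 hb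
      exact hf (h3 i j hij a' ha' b' hb')
    · intro i a ha
      obtain ⟨a', ha', rfl⟩ := Finset.mem_image.1 ha
      have := h4 i a' ha'
      have := hf.le_apply (x := a')
      omega
    · rw [Finset.biUnion_image]
  | limit η hη hl ih =>
    intro E hE
    rw [mem_schreier_limit hφ hη hl] at hE ⊢
    obtain ⟨n, h1, h2⟩ := hE
    refine ⟨n, fun i hi => ?_, ih _ (hφ.lt hη hl n) _ h2⟩
    obtain ⟨a, ha, rfl⟩ := Finset.mem_image.1 hi
    exact (h1 a ha).trans hf.le_apply

/-- For arbitrary ladders the families need not increase with the ordinal. Inclusion holds past a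
threshold because at a limit some ladder term exceeds `α`, and only points beyond its index are
considered. -/
theorem schreier_eventually_subset (hφ : IsLadder φ) {α β : Ordinal.{0}} (hβ : β < ω₁)
    (hαβ : α ≤ β) : ∃ q : ℕ, ∀ E ∈ schreier φ α, (∀ i ∈ E, q ≤ i) → E ∈ schreier φ β := by
  induction hβ using induction_lt_omega1 with
  | zero _ =>
    obtain rfl : α = 0 := le_antisymm hαβ zero_le
    exact ⟨0, fun E hE _ => hE⟩
  | add_one β _ _ ih =>
    rcases hαβ.eq_or_lt with rfl | h
    · exact ⟨0, fun E hE _ => hE⟩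
    · obtain ⟨q, hq⟩ := ih (Order.lt_add_one_iff.1 h)
      exact ⟨q, fun E hE h => schreier_subset_add_one (hq E hE h)⟩
  | limit η hη hl ih =>
    rcases hαβ.eq_or_lt with rfl | h
    · exact ⟨0, fun E hE _ => hE⟩
    · obtain ⟨n, hn⟩ := hφ.exists_lt hη hl h
      obtain ⟨q, hq⟩ := ih _ (hφ.lt hη hl n) hn.le
      refine ⟨max n q, fun E hE h => (mem_schreier_limit hφ hη hl).2 ⟨n, fun i hi => ?_, ?_⟩⟩
      · exact (le_max_left _ _).trans (h i hi)
      · exact hq E hE fun i hi => (le_max_right _ _).trans (h i hi)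

theorem singleton_mem_schreier (hφ : IsLadder φ) {α : Ordinal.{0}} (hα : α < ω₁) (i : ℕ) :
    {i} ∈ schreier φ α := by
  induction hα using induction_lt_omega1 with
  | zero _ => simp [mem_schreier_zero]
  | add_one α _ _ ih => exact schreier_subset_add_one ih
  | limit η hη hl ih =>
    exact (mem_schreier_limit hφ hη hl).2 ⟨0, fun _ _ => Nat.zero_le _, ih _ (hφ.lt hη hl 0)⟩

theorem mem_schreier_one {E : Finset ℕ} :
    E ∈ schreier φ 1 ↔ ∃ n, (∀ i ∈ E, n ≤ i) ∧ E.card ≤ n + 1 := by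
  rw [← zero_add (1 : Ordinal.{0}), schreier_add_one, mem_familyBracket_schreierOne]
  constructor
  · rintro ⟨n, G, h1, h2, h3, h4, rfl⟩
    -- Admissibility reads `n ≤ a + 1`. For `n = 0` the union is empty and the truncated subtraction
    -- is harmless.
    refine ⟨n - 1, fun i hi => ?_, ?_⟩
    · obtain ⟨j, -, hj⟩ := Finset.mem_biUnion.1 hi
      have := h4 j i hj
      omega
    · have := Finset.card_biUnion_le_card_mul Finset.univ G 1 fun i _ => mem_schreier_zero.1 (h2 i)
      simp at this
      simp
      omega
  · rintro ⟨n, h1, h2⟩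
    refine ⟨E.card, fun i => {E.orderEmbOfFin rfl i}, fun i => by simp, fun i => ?_, ?_, ?_, ?_⟩
    · simp [mem_schreier_zero]
    · intro i j hij a ha b hb
      rw [Finset.mem_singleton] at ha hb
      subst ha hb
      exact (E.orderEmbOfFin rfl).strictMono hij
    · intro i a ha
      rw [Finset.mem_singleton] at ha
      subst ha
      have := h1 _ (E.orderEmbOfFin_mem rfl i)
      omega
    · ext a
      have := Finset.range_orderEmbOfFin E (rfl : E.card = E.card)
      rw [← Finset.mem_coe, ← this]
      simp only [Set.mem_range, Finset.mem_biUnion, Finset.mem_univ, true_and,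
        Finset.mem_singleton, eq_comm]

/-- `F i`, `i ∈ E`, are nonempty and successive. -/
def IsSuccessiveOn (F : ℕ → Finset ℕ) (E : Finset ℕ) : Prop :=
  (∀ i ∈ E, (F i).Nonempty) ∧ ∀ i ∈ E, ∀ j ∈ E, i < j → ∀ a ∈ F i, ∀ b ∈ F j, a < b

theorem IsSuccessiveOn.mono {F : ℕ → Finset ℕ} {E E' : Finset ℕ} (h : IsSuccessiveOn F E)
    (hE : E' ⊆ E) : IsSuccessiveOn F E' :=
  ⟨fun i hi => h.1 i (hE hi), fun i hi j hj => h.2 i (hE hi) j (hE hj)⟩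

theorem IsSuccessiveOn.pairwiseDisjoint {F : ℕ → Finset ℕ} {E : Finset ℕ}
    (h : IsSuccessiveOn F E) : (E : Set ℕ).PairwiseDisjoint F := by
  intro i hi j hj hij
  refine Finset.disjoint_left.2 fun a ha hb => ?_
  rcases lt_or_gt_of_ne hij with h' | h'
  · exact lt_irrefl _ (h.2 i hi j hj h' a ha a hb)
  · exact lt_irrefl _ (h.2 j hj i hi h' a hb a ha)

/-- A sufficiently sparse union of successive members of `𝒮_β` along a member of `𝒮_α` belongs to
`𝒮_{β + α}`. -/
theorem schreier_biUnion_mem (hφ : IsLadder φ) {α β : Ordinal.{0}} (hα : α < ω₁)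
    (hβα : β + α < ω₁) :
    ∃ g : ℕ → ℕ, ∀ E ∈ schreier φ α, ∀ F : ℕ → Finset ℕ, IsSuccessiveOn F E →
      (∀ i ∈ E, F i ∈ schreier φ β) → (∀ i ∈ E, ∀ a ∈ F i, g i ≤ a) →
      E.biUnion F ∈ schreier φ (β + α) := by
  have empty_mem : ∀ γ : Ordinal.{0}, γ < ω₁ → ∅ ∈ schreier φ γ := by
    intro γ hγ
    obtain ⟨q, hq⟩ := schreier_eventually_subset hφ hγ (zero_le)
    exact hq ∅ (by simp [mem_schreier_zero]) (by simp)
  induction hα using induction_lt_omega1 with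
  | zero _ =>
    refine ⟨0, fun E hE F _ hF _ => ?_⟩
    rw [mem_schreier_zero, Finset.card_le_one_iff_subset_singleton] at hE
    obtain ⟨i, hi⟩ := hE
    rw [add_zero] at hβα ⊢
    rcases Finset.subset_singleton_iff.1 hi with rfl | rfl
    · simpa using empty_mem β hβα
    · simpa using hF i (by simp)
  | add_one α _ _ ih =>
    rw [← add_assoc] at hβα ⊢
    obtain ⟨g, hg⟩ := ih ((lt_add_one _).trans hβα)
    -- The bound `i ≤ a` for `a ∈ F i` transfers the admissibility of the outer sets `G k` to the
    -- unions over them.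
    refine ⟨fun i => max i (g i), fun E hE F hs hF hgF => ?_⟩
    rw [schreier_add_one, mem_familyBracket_schreierOne] at hE ⊢
    obtain ⟨n, G, h1, h2, h3, h4, rfl⟩ := hE
    have hsub : ∀ k, G k ⊆ Finset.univ.biUnion G := fun k =>
      Finset.subset_biUnion_of_mem G (Finset.mem_univ k)
    refine ⟨n, fun k => (G k).biUnion F, fun k => ?_, fun k => ?_, ?_, ?_, ?_⟩
    · obtain ⟨i, hi⟩ := h1 k
      obtain ⟨a, ha⟩ := hs.1 i (hsub k hi)
      exact ⟨a, Finset.mem_biUnion.2 ⟨i, hi, ha⟩⟩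
    · exact hg _ (h2 k) F (hs.mono (hsub k)) (fun i hi => hF i (hsub k hi))
        fun i hi a ha => (le_max_right _ _).trans (hgF i (hsub k hi) a ha)
    · intro k l hkl a ha b hb
      obtain ⟨i, hi, ha⟩ := Finset.mem_biUnion.1 ha
      obtain ⟨j, hj, hb⟩ := Finset.mem_biUnion.1 hb
      exact hs.2 i (hsub k hi) j (hsub l hj) (h3 k l hkl i hi j hj) a ha b hb
    · intro k a ha
      obtain ⟨i, hi, ha⟩ := Finset.mem_biUnion.1 ha
      have := h4 k i hi
      have := (le_max_left _ _).trans (hgF i (hsub k hi) a ha)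
      omega
    · rw [Finset.biUnion_biUnion]
  | limit η hη hl ih =>
    have hlt : ∀ n, β + φ η n < β + η := fun n => by
      gcongr; exact hφ.lt hη hl n
    choose g hg using fun n => ih _ (hφ.lt hη hl n) ((hlt n).trans hβα)
    choose q hq using fun n => schreier_eventually_subset hφ hβα (hlt n).le
    -- The level `n` with `E ∈ 𝒮_{φ η n}` is not known in advance, but it is at most every `i ∈ E`,
    -- so a finite supremum suffices. The thresholds `q n` are needed since the ladder at `β + η` is
    -- unrelated to the ordinals `β + φ η n`.
    refine ⟨fun i => (Finset.range (i + 1)).sup fun n => max (g n i) (q n),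
      fun E hE F hs hF hgF => ?_⟩
    obtain ⟨n, hn, hE⟩ := (mem_schreier_limit hφ hη hl).1 hE
    have key : ∀ i ∈ E, ∀ a ∈ F i, max (g n i) (q n) ≤ a := fun i hi a ha =>
      (Finset.le_sup (f := fun n => max (g n i) (q n))
        (Finset.mem_range.2 (Nat.lt_succ_of_le (hn i hi)))).trans (hgF i hi a ha)
    refine hq n _ (hg n E hE F hs hF fun i hi a ha => (le_max_left _ _).trans (key i hi a ha)) ?_
    intro a ha
    obtain ⟨i, hi, ha⟩ := Finset.mem_biUnion.1 ha
    exact (le_max_right _ _).trans (key i hi a ha)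

/-- `𝓕` approximates `𝒮`, and the families `𝓕 n` are closed under sparse unions of successive
sets along each other. -/
structure IsBlockClosed (𝓕 : ℕ → Set (Finset ℕ)) (𝒮 : Set (Finset ℕ)) : Prop where
  mem_iff : ∀ E, E ∈ 𝒮 ↔ ∃ n, (∀ i ∈ E, n ≤ i) ∧ E ∈ 𝓕 n
  biUnion_mem : ∀ m n, ∃ k, ∃ g : ℕ → ℕ, ∀ E ∈ 𝓕 m, ∀ F : ℕ → Finset ℕ, IsSuccessiveOn F E →
    (∀ i ∈ E, F i ∈ 𝓕 n) → (∀ i ∈ E, ∀ a ∈ F i, g i ≤ a) → E.biUnion F ∈ 𝓕 k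
  image_mem : ∀ f : ℕ → ℕ, StrictMono f → ∀ E ∈ 𝒮, E.image f ∈ 𝒮
  singleton_mem : ∀ i, {i} ∈ 𝒮
  pair_mem : ∃ n M, ∀ E : Finset ℕ, E.card ≤ 2 → (∀ i ∈ E, M ≤ i) → E ∈ 𝓕 n

theorem omega0_opow_lt_omega1 {ξ : Ordinal.{0}} (hξ : ξ < ω₁) : ω ^ ξ < ω₁ :=
  Ordinal.isPrincipal_opow_omega 1 (by simp) hξ

/-- For `ξ ≠ 0`, the sum of two ladder terms stays below `ω ^ ξ`, hence below a third term. For `ξ =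
0` the ordinal is `1`, not a limit, and cardinality bounds replace the ladder families; these bounds
multiply. -/
theorem exists_isBlockClosed_schreier (hφ : IsLadder φ) {ξ : Ordinal.{0}} (hξ : ξ < ω₁) :
    ∃ 𝓕, IsBlockClosed 𝓕 (schreier φ (ω ^ ξ)) := by
  have hω := omega0_opow_lt_omega1 hξ
  rcases eq_or_ne ξ 0 with rfl | h0
  · refine ⟨fun n => {E | E.card ≤ n + 1}, ?_, fun m n => ?_, fun f hf => schreier_image hφ hω hf,
      singleton_mem_schreier hφ hω, 1, 0, fun E hE _ => hE⟩
    · intro E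
      rw [Ordinal.opow_zero, mem_schreier_one]
      rfl
    · refine ⟨(m + 1) * (n + 1), 0, fun E hE F _ hF _ => ?_⟩
      calc (E.biUnion F).card ≤ E.card * (n + 1) := Finset.card_biUnion_le_card_mul _ _ _ hF
        _ ≤ (m + 1) * (n + 1) := by gcongr; exact hE
        _ ≤ _ := Nat.le_succ _
  · have hl : Order.IsSuccLimit (ω ^ ξ) :=
      Ordinal.isSuccLimit_opow_left Ordinal.isSuccLimit_omega0 h0
    refine ⟨fun n => schreier φ (φ (ω ^ ξ) n), fun E => mem_schreier_limit hφ hω hl, fun m n => ?_,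
      fun f hf => schreier_image hφ hω hf, singleton_mem_schreier hφ hω, ?_⟩
    · have hsum : φ (ω ^ ξ) n + φ (ω ^ ξ) m < ω ^ ξ :=
        Ordinal.isPrincipal_add_omega0_opow ξ (hφ.lt hω hl n) (hφ.lt hω hl m)
      obtain ⟨k, hk⟩ := hφ.exists_lt hω hl hsum
      obtain ⟨q, hq⟩ := schreier_eventually_subset hφ ((hφ.lt hω hl k).trans hω) hk.le
      obtain ⟨g, hg⟩ := schreier_biUnion_mem hφ ((hφ.lt hω hl m).trans hω) (hsum.trans hω)
      refine ⟨k, fun i => max q (g i), fun E hE F hs hF hgF => hq _ (hg E hE F hs hF ?_) ?_⟩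
      · exact fun i hi a ha => (le_max_right _ _).trans (hgF i hi a ha)
      · intro a ha
        obtain ⟨i, hi, ha⟩ := Finset.mem_biUnion.1 ha
        exact (le_max_left _ _).trans (hgF i hi a ha)
    · obtain ⟨n, hn⟩ := hφ.exists_lt hω hl (Ordinal.one_lt_of_isSuccLimit hl)
      obtain ⟨q, hq⟩ := schreier_eventually_subset hφ ((hφ.lt hω hl n).trans hω) hn.le
      refine ⟨n, max q 1, fun E hE hM => hq E (mem_schreier_one.2 ⟨1, fun i hi => ?_, hE⟩) ?_⟩
      · exact (le_max_right _ _).trans (hM i hi)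
      · exact fun i hi => (le_max_left _ _).trans (hM i hi)

/-! ### Blockings of sequences -/

section Blocking

variable {𝕜 : Type*} [RCLike 𝕜] {X : Type*} [NormedAddCommGroup X] [NormedSpace 𝕜 X]

/-- The properties shared by the `ℓ₁` norm and the `c₀` norm of finite families of scalars. -/
structure IsGauge (N : Finset ℕ → (ℕ → 𝕜) → ℝ) : Prop where
  nonneg : ∀ E a, 0 ≤ N E a
  zero : ∀ E a, (∀ i ∈ E, a i = 0) → N E a = 0
  smul : ∀ E a t, N E (fun i => t * a i) = ‖t‖ * N E a
  le : ∀ E a, ∀ i ∈ E, ‖a i‖ ≤ N E a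
  single : ∀ i a, N {i} a = ‖a i‖
  biUnion : ∀ (E : Finset ℕ) (F : ℕ → Finset ℕ) (b : ℕ → 𝕜) (a : ℕ → ℕ → 𝕜) (c : ℕ → 𝕜),
    IsSuccessiveOn F E → (∀ i ∈ E, N (F i) (a i) = 1) →
    (∀ i ∈ E, ∀ j ∈ F i, c j = b i * a i j) → N (E.biUnion F) c = N E b

theorem isGauge_ellOne : IsGauge fun (E : Finset ℕ) (a : ℕ → 𝕜) => ∑ i ∈ E, ‖a i‖ where
  nonneg E a := Finset.sum_nonneg fun _ _ => norm_nonneg _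
  zero E a h := Finset.sum_eq_zero fun i hi => by simp [h i hi]
  smul E a t := by simp [Finset.mul_sum]
  le E a i hi := Finset.single_le_sum (f := fun i => ‖a i‖) (fun _ _ => norm_nonneg _) hi
  single i a := by simp
  biUnion E F b a c hs h1 hc := by
    rw [Finset.sum_biUnion hs.pairwiseDisjoint]
    refine Finset.sum_congr rfl fun i hi => ?_
    rw [← mul_one ‖b i‖, ← h1 i hi, Finset.mul_sum]
    exact Finset.sum_congr rfl fun j hj => by rw [hc i hi j hj, norm_mul]

theorem isGauge_cZero :
    IsGauge fun (E : Finset ℕ) (a : ℕ → 𝕜) => ((E.sup (fun i => ‖a i‖₊) : NNReal) : ℝ) where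
  nonneg E a := NNReal.coe_nonneg _
  zero E a h := by
    have : E.sup (fun i => ‖a i‖₊) ≤ 0 := Finset.sup_le fun i hi => by simp [h i hi]
    simpa using this
  smul E a t := by
    simp only [nnnorm_mul]
    rw [← NNReal.mul_finset_sup, NNReal.coe_mul, coe_nnnorm]
  le E a i hi := by
    rw [← coe_nnnorm, NNReal.coe_le_coe]
    exact Finset.le_sup (f := fun i => ‖a i‖₊) hi
  single i a := by simp
  biUnion E F b a c hs h1 hc := by
    rw [NNReal.coe_inj, Finset.sup_biUnion]
    refine Finset.sup_congr rfl fun i hi => ?_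
    have h : (F i).sup (fun j => ‖a i j‖₊) = 1 := by exact_mod_cast h1 i hi
    rw [← mul_one ‖b i‖₊, ← h, NNReal.mul_finset_sup]
    exact Finset.sup_congr rfl fun j hj => by rw [hc i hi j hj, nnnorm_mul]

variable {N : Finset ℕ → (ℕ → 𝕜) → ℝ} {𝓕 : ℕ → Set (Finset ℕ)} {𝒮 : Set (Finset ℕ)}
  {x y : ℕ → X}

/-- On the members of `𝒮`, the seminorm `q` of linear combinations of `x` lies between `c N` and
`C N`. -/
def IsEstimate (N : Finset ℕ → (ℕ → 𝕜) → ℝ) (𝒮 : Set (Finset ℕ)) (q : Seminorm 𝕜 X) (x : ℕ → X)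
    (c C : ℝ) : Prop :=
  ∀ E ∈ 𝒮, ∀ a : ℕ → 𝕜, c * N E a ≤ q (∑ i ∈ E, a i • x i) ∧ q (∑ i ∈ E, a i • x i) ≤ C * N E a

/-- `y` consists of successive `N`-normalized blocks of `x`, and unions of these blocks along
members of `𝒮` are again in `𝒮`. -/
def IsBlocking (N : Finset ℕ → (ℕ → 𝕜) → ℝ) (𝒮 : Set (Finset ℕ)) (x y : ℕ → X) : Prop :=
  ∃ (F : ℕ → Finset ℕ) (a : ℕ → ℕ → 𝕜), (∀ E, IsSuccessiveOn F E) ∧ (∀ i, N (F i) (a i) = 1) ∧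
    (∀ i, y i = ∑ j ∈ F i, a i j • x j) ∧ ∀ E ∈ 𝒮, E.biUnion F ∈ 𝒮

theorem IsSuccessiveOn.exists_coeff {F : ℕ → Finset ℕ} {E : Finset ℕ} (h : IsSuccessiveOn F E)
    (b : ℕ → 𝕜) (a : ℕ → ℕ → 𝕜) : ∃ c : ℕ → 𝕜, ∀ i ∈ E, ∀ j ∈ F i, c j = b i * a i j := by
  refine ⟨fun j => ∑ i ∈ E, if j ∈ F i then b i * a i j else 0, fun i hi j hj => ?_⟩
  beta_reduce
  rw [Finset.sum_eq_single_of_mem i hi, if_pos hj]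
  intro k hk hki
  exact if_neg fun hjk => Finset.disjoint_left.1 (h.pairwiseDisjoint hk hi hki) hjk hj

theorem IsSuccessiveOn.sum_biUnion {F : ℕ → Finset ℕ} {E : Finset ℕ} (h : IsSuccessiveOn F E)
    {b : ℕ → 𝕜} {a : ℕ → ℕ → 𝕜} {c : ℕ → 𝕜} (hc : ∀ i ∈ E, ∀ j ∈ F i, c j = b i * a i j)
    (x : ℕ → X) :
    ∑ j ∈ E.biUnion F, c j • x j = ∑ i ∈ E, b i • ∑ j ∈ F i, a i j • x j := by
  rw [Finset.sum_biUnion h.pairwiseDisjoint]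
  refine Finset.sum_congr rfl fun i hi => ?_
  rw [Finset.smul_sum]
  exact Finset.sum_congr rfl fun j hj => by rw [hc i hi j hj, mul_smul]

theorem IsBlocking.isEstimate (hN : IsGauge N) (h : IsBlocking N 𝒮 x y) {q : Seminorm 𝕜 X}
    {c C : ℝ} (hx : IsEstimate N 𝒮 q x c C) : IsEstimate N 𝒮 q y c C := by
  obtain ⟨F, a, hs, h1, hy, hU⟩ := h
  intro E hE b
  obtain ⟨d, hd⟩ := (hs E).exists_coeff b a
  simp only [hy, ← (hs E).sum_biUnion hd x]
  rw [← hN.biUnion E F b a d (hs E) (fun i _ => h1 i) hd]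
  exact hx _ (hU E hE) d

theorem isBlocking_comp (hN : IsGauge N) (h𝓕 : IsBlockClosed 𝓕 𝒮) {f : ℕ → ℕ} (hf : StrictMono f) :
    IsBlocking N 𝒮 x (x ∘ f) := by
  refine ⟨fun i => {f i}, fun _ _ => 1, fun E => ⟨by simp, ?_⟩, fun i => ?_, fun i => by simp,
    fun E hE => ?_⟩
  · intro i _ j _ hij a ha b hb
    rw [Finset.mem_singleton] at ha hb
    subst ha hb
    exact hf hij
  · simp [hN.single]
  · rw [Finset.biUnion_singleton]
    exact h𝓕.image_mem f hf E hE

/-- Blocks with prescribed properties can be selected so sparsely that they form a blocking whose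
`𝒮`-combinations inherit what holds eventually for each `𝓕 k`. -/
theorem IsBlockClosed.exists_isBlocking (hN : IsGauge N) (h𝓕 : IsBlockClosed 𝓕 𝒮)
    {P : ℕ → X → Prop} {R : X → Prop} {n : ℕ}
    (hP : ∀ i M : ℕ, ∃ E ∈ 𝓕 n, (∀ j ∈ E, M ≤ j) ∧
      ∃ a : ℕ → 𝕜, N E a = 1 ∧ P i (∑ j ∈ E, a j • x j))
    (hR : ∀ k, ∃ M : ℕ, ∀ E ∈ 𝓕 k, (∀ j ∈ E, M ≤ j) →
      ∀ a : ℕ → 𝕜, N E a = 1 → R (∑ j ∈ E, a j • x j)) :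
    ∃ y, IsBlocking N 𝒮 x y ∧ (∀ i, P i (y i)) ∧
      ∀ E ∈ 𝒮, ∀ b : ℕ → 𝕜, N E b = 1 → R (∑ i ∈ E, b i • y i) := by
  choose G hG hGM a ha hPa using hP
  choose K hK using hR
  choose k g hg using fun m => h𝓕.biUnion_mem m n
  -- Diagonalization: block `i` respects the thresholds of all levels `m ≤ i`, the only levels at
  -- which `i` can belong to an admissible set.
  let h : ℕ → ℕ := fun i => (Finset.range (i + 1)).sup fun m => max (g m i) (max (k m) (K (k m)))
  have hh : ∀ m i, m ≤ i → max (g m i) (max (k m) (K (k m))) ≤ h i := fun m i hmi =>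
    Finset.le_sup (f := fun m => max (g m i) (max (k m) (K (k m))))
      (Finset.mem_range.2 (Nat.lt_succ_of_le hmi))
  -- `B i` is where block `i` may start: beyond `h i` and beyond the end of the previous block.
  let B : ℕ → ℕ := fun i => Nat.rec (h 0)
    (fun i M => max (h (i + 1)) ((G i M).sup id + 1)) i
  have hB : ∀ i, h i ≤ B i := by
    rintro (_ | i)
    · exact le_rfl
    · exact le_max_left _ _
  have hGB : ∀ i, ∀ j ∈ G i (B i), j < B (i + 1) := fun i j hj =>
    lt_of_lt_of_le (Nat.lt_succ_of_le (Finset.le_sup (f := id) hj)) (le_max_right _ _)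
  have hne : ∀ i, (G i (B i)).Nonempty := fun i => by
    rw [Finset.nonempty_iff_ne_empty]
    intro h0
    have h1 := ha i (B i)
    rw [h0, hN.zero _ _ (by simp)] at h1
    exact zero_ne_one h1
  have hBmono : StrictMono B := strictMono_nat_of_lt_succ fun i => by
    obtain ⟨j, hj⟩ := hne i
    exact (hGM i (B i) j hj).trans_lt (hGB i j hj)
  have hs : ∀ E, IsSuccessiveOn (fun i => G i (B i)) E := fun E =>
    ⟨fun i _ => hne i, fun i _ j _ hij p hp q hq =>
      (hGB i p hp).trans_le ((hBmono.monotone hij).trans (hGM j (B j) q hq))⟩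
  have hle : ∀ m i, m ≤ i → ∀ p ∈ G i (B i), max (g m i) (max (k m) (K (k m))) ≤ p :=
    fun m i hmi p hp => (hh m i hmi).trans ((hB i).trans (hGM i (B i) p hp))
  have key : ∀ E m, (∀ i ∈ E, m ≤ i) → E ∈ 𝓕 m →
      E.biUnion (fun i => G i (B i)) ∈ 𝓕 (k m) ∧
        ∀ p ∈ E.biUnion (fun i => G i (B i)), k m ≤ p ∧ K (k m) ≤ p := by
    intro E m hm hE
    refine ⟨hg m E hE _ (hs E) (fun i _ => hG i (B i)) fun i hi p hp =>
      (le_max_left _ _).trans (hle m i (hm i hi) p hp), fun p hp => ?_⟩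
    obtain ⟨i, hi, hp⟩ := Finset.mem_biUnion.1 hp
    exact max_le_iff.1 ((le_max_right _ _).trans (hle m i (hm i hi) p hp))
  refine ⟨fun i => ∑ j ∈ G i (B i), a i (B i) j • x j, ⟨_, fun i => a i (B i), hs,
    fun i => ha i (B i), fun i => rfl, fun E hE => ?_⟩, fun i => hPa i (B i), fun E hE b hb => ?_⟩
  · obtain ⟨m, hm, hE⟩ := (h𝓕.mem_iff E).1 hE
    obtain ⟨h1, h2⟩ := key E m hm hE
    exact (h𝓕.mem_iff _).2 ⟨k m, fun p hp => (h2 p hp).1, h1⟩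
  · obtain ⟨m, hm, hE⟩ := (h𝓕.mem_iff E).1 hE
    obtain ⟨h1, h2⟩ := key E m hm hE
    obtain ⟨c, hc⟩ := (hs E).exists_coeff b fun i => a i (B i)
    rw [← (hs E).sum_biUnion hc x]
    refine hK (k m) _ h1 (fun p hp => (h2 p hp).2) c ?_
    rw [hN.biUnion E _ b _ c (hs E) (fun i _ => ha i (B i)) hc, hb]

theorem IsGauge.le_of_normalized (hN : IsGauge N) {E : Finset ℕ} {q : Seminorm 𝕜 X} {c : ℝ}
    (h : ∀ a : ℕ → 𝕜, N E a = 1 → c ≤ q (∑ i ∈ E, a i • x i)) (a : ℕ → 𝕜) :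
    c * N E a ≤ q (∑ i ∈ E, a i • x i) := by
  rcases (hN.nonneg E a).eq_or_lt with h0 | h0
  · simp [← h0]
  · have hn : ‖((N E a : ℝ) : 𝕜)⁻¹‖ = (N E a)⁻¹ := by
      rw [norm_inv, RCLike.norm_ofReal, abs_of_pos h0]
    have h1 := h (fun i => ((N E a : ℝ) : 𝕜)⁻¹ * a i)
      (by rw [hN.smul, hn, inv_mul_cancel₀ h0.ne'])
    simp only [mul_smul, ← Finset.smul_sum] at h1
    rwa [map_smul_eq_mul, hn, le_inv_mul_iff₀ h0, mul_comm] at h1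

theorem IsGauge.le_mul_of_normalized (hN : IsGauge N) {E : Finset ℕ} {q : Seminorm 𝕜 X} {C : ℝ}
    (h : ∀ a : ℕ → 𝕜, N E a = 1 → q (∑ i ∈ E, a i • x i) ≤ C) (a : ℕ → 𝕜) :
    q (∑ i ∈ E, a i • x i) ≤ C * N E a := by
  rcases (hN.nonneg E a).eq_or_lt with h0 | h0
  · have : ∀ i ∈ E, a i = 0 := fun i hi =>
      norm_le_zero_iff.1 ((hN.le E a i hi).trans h0.symm.le)
    rw [Finset.sum_eq_zero fun i hi => by rw [this i hi, zero_smul]]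
    simp [← h0]
  · have hn : ‖((N E a : ℝ) : 𝕜)⁻¹‖ = (N E a)⁻¹ := by
      rw [norm_inv, RCLike.norm_ofReal, abs_of_pos h0]
    have h1 := h (fun i => ((N E a : ℝ) : 𝕜)⁻¹ * a i)
      (by rw [hN.smul, hn, inv_mul_cancel₀ h0.ne'])
    simp only [mul_smul, ← Finset.smul_sum] at h1
    rwa [map_smul_eq_mul, hn, inv_mul_le_iff₀ h0, mul_comm] at h1

end Blocking

/-! ### Stabilization of seminorms on blockings -/

section Stabilization

variable {𝕜 : Type*} [RCLike 𝕜] {X : Type*} [NormedAddCommGroup X] [NormedSpace 𝕜 X]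
  {N : Finset ℕ → (ℕ → 𝕜) → ℝ} {𝓕 : ℕ → Set (Finset ℕ)} {𝒮 : Set (Finset ℕ)}

theorem IsBlockClosed.exists_normalized (hN : IsGauge N) (h𝓕 : IsBlockClosed 𝓕 𝒮) :
    ∃ n, ∀ M : ℕ, ∃ E ∈ 𝓕 n, (∀ j ∈ E, M ≤ j) ∧ E ∈ 𝒮 ∧ ∃ a : ℕ → 𝕜, N E a = 1 := by
  obtain ⟨n, M₀, h⟩ := h𝓕.pair_mem
  refine ⟨n, fun M => ⟨{max M M₀}, h _ (by simp) (by simp), by simp, h𝓕.singleton_mem _,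
    fun _ => 1, by simp [hN.single]⟩⟩

/-- `Θ` is the smallest asymptotic value of `q` on normalized vectors supported in one level `𝓕 n`.
Blocks nearly attaining it satisfy the upper estimate by the triangle inequality; their combinations
are again supported in one level, so they cannot fall much below `Θ`. -/
theorem exists_isBlocking_isEstimate_ellOne
    (hN : N = fun (E : Finset ℕ) (a : ℕ → 𝕜) => ∑ i ∈ E, ‖a i‖)
    (h𝓕 : IsBlockClosed 𝓕 𝒮) {x : ℕ → X} {q : Seminorm 𝕜 X} {c C δ : ℝ} (hc : 0 < c)
    (hx : IsEstimate N 𝒮 q x c C) (hδ : 0 < δ) :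
    ∃ y Θ, 0 < Θ ∧ IsBlocking N 𝒮 x y ∧ IsEstimate N 𝒮 q y ((1 - δ) * Θ) ((1 + δ) * Θ) := by
  have hG : IsGauge N := hN ▸ isGauge_ellOne
  let A : Set ℝ := {r | ∃ n, ∀ M : ℕ, ∃ E ∈ 𝓕 n, (∀ j ∈ E, M ≤ j) ∧
    ∃ a : ℕ → 𝕜, N E a = 1 ∧ q (∑ j ∈ E, a j • x j) ≤ r}
  have hne : A.Nonempty := by
    obtain ⟨n, hn⟩ := h𝓕.exists_normalized hG
    refine ⟨C, n, fun M => ?_⟩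
    obtain ⟨E, hE, hM, hS, a, ha⟩ := hn M
    exact ⟨E, hE, hM, a, ha, by simpa [ha] using (hx E hS a).2⟩
  have hlow : ∀ r ∈ A, c ≤ r := by
    rintro r ⟨n, hn⟩
    -- Going beyond `n` itself places `E` in `𝒮`, where `hx` applies.
    obtain ⟨E, hE, hM, a, ha, hr⟩ := hn n
    have := (hx E ((h𝓕.mem_iff E).2 ⟨n, hM, hE⟩) a).1
    rw [ha, mul_one] at this
    exact this.trans hr
  have hΘ : 0 < sInf A := hc.trans_le (le_csInf hne hlow)
  obtain ⟨r, ⟨n, hn⟩, hr⟩ := exists_lt_of_csInf_lt hne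
    (show sInf A < (1 + δ) * sInf A by nlinarith)
  obtain ⟨y, hxy, hP, hR⟩ := h𝓕.exists_isBlocking hG (x := x)
    (P := fun _ v => q v ≤ (1 + δ) * sInf A) (R := fun v => (1 - δ) * sInf A ≤ q v) (n := n)
    (fun _ M => by
      obtain ⟨E, hE, hM, a, ha, h⟩ := hn M
      exact ⟨E, hE, hM, a, ha, h.trans hr.le⟩)
    (fun k => by
      -- Otherwise level `k` would witness `(1 - δ) * sInf A ∈ A`, below the infimum.
      by_contra! hk
      have : (1 - δ) * sInf A ∈ A := ⟨k, fun M => by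
        obtain ⟨E, hE, hM, a, ha, h⟩ := hk M
        exact ⟨E, hE, hM, a, ha, h.le⟩⟩
      have := csInf_le ⟨c, hlow⟩ this
      nlinarith)
  refine ⟨y, sInf A, hΘ, hxy, fun E hE b => ⟨hG.le_of_normalized (hR E hE) b, ?_⟩⟩
  calc q (∑ i ∈ E, b i • y i) ≤ ∑ i ∈ E, q (b i • y i) :=
        Finset.le_sum_of_subadditive q (map_zero q).le (map_add_le_add q) _ _
    _ ≤ ∑ i ∈ E, (1 + δ) * sInf A * ‖b i‖ := Finset.sum_le_sum fun i _ => by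
        rw [map_smul_eq_mul, mul_comm]
        exact mul_le_mul_of_nonneg_right (hP i) (norm_nonneg _)
    _ = (1 + δ) * sInf A * N E b := by rw [hN, Finset.mul_sum]

/-- Dual to the `ℓ₁` case: `Θ` is the largest asymptotic value, so the upper estimate is automatic
for combinations. The lower one follows from it by a change of signs. -/
theorem exists_isBlocking_isEstimate_cZero
    (hN : N = fun (E : Finset ℕ) (a : ℕ → 𝕜) => ((E.sup (fun i => ‖a i‖₊) : NNReal) : ℝ))
    (h𝓕 : IsBlockClosed 𝓕 𝒮) {x : ℕ → X} {q : Seminorm 𝕜 X} {c C δ : ℝ} (hc : 0 < c)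
    (hx : IsEstimate N 𝒮 q x c C) (hδ : 0 < δ) :
    ∃ y Θ, 0 < Θ ∧ IsBlocking N 𝒮 x y ∧ IsEstimate N 𝒮 q y ((1 - δ) * Θ) ((1 + δ) * Θ) := by
  have hG : IsGauge N := hN ▸ isGauge_cZero
  let A : Set ℝ := {r | ∃ n, ∀ M : ℕ, ∃ E ∈ 𝓕 n, (∀ j ∈ E, M ≤ j) ∧
    ∃ a : ℕ → 𝕜, N E a = 1 ∧ r ≤ q (∑ j ∈ E, a j • x j)}
  have hcA : c ∈ A := by
    obtain ⟨n, hn⟩ := h𝓕.exists_normalized hG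
    refine ⟨n, fun M => ?_⟩
    obtain ⟨E, hE, hM, hS, a, ha⟩ := hn M
    exact ⟨E, hE, hM, a, ha, by simpa [ha] using (hx E hS a).1⟩
  have hup : ∀ r ∈ A, r ≤ C := by
    rintro r ⟨n, hn⟩
    obtain ⟨E, hE, hM, a, ha, hr⟩ := hn n
    have := (hx E ((h𝓕.mem_iff E).2 ⟨n, hM, hE⟩) a).2
    rw [ha, mul_one] at this
    exact hr.trans this
  have hΘ : 0 < sSup A := hc.trans_le (le_csSup ⟨C, hup⟩ hcA)
  obtain ⟨r, ⟨n, hn⟩, hr⟩ := exists_lt_of_lt_csSup ⟨c, hcA⟩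
    (show (1 - δ / 3) * sSup A < sSup A by nlinarith)
  obtain ⟨y, hxy, hP, hR⟩ := h𝓕.exists_isBlocking hG (x := x)
    (P := fun _ v => (1 - δ / 3) * sSup A ≤ q v) (R := fun v => q v ≤ (1 + δ / 3) * sSup A) (n := n)
    (fun _ M => by
      obtain ⟨E, hE, hM, a, ha, h⟩ := hn M
      exact ⟨E, hE, hM, a, ha, hr.le.trans h⟩)
    (fun k => by
      by_contra! hk
      have : (1 + δ / 3) * sSup A ∈ A := ⟨k, fun M => by
        obtain ⟨E, hE, hM, a, ha, h⟩ := hk M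
        exact ⟨E, hE, hM, a, ha, h.le⟩⟩
      have := le_csSup ⟨C, hup⟩ this
      nlinarith)
  refine ⟨y, sSup A, hΘ, hxy, fun E hE b => ⟨hG.le_of_normalized (fun b hb => ?_) b,
    hG.le_mul_of_normalized (fun b hb => (hR E hE b hb).trans ?_) b⟩⟩
  · have hEne : E.Nonempty := by
      rw [Finset.nonempty_iff_ne_empty]
      rintro rfl
      rw [hG.zero _ _ (by simp)] at hb
      exact zero_ne_one hb
    obtain ⟨i₀, hi₀, hsup⟩ := E.exists_mem_eq_sup hEne fun i => ‖b i‖₊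
    have hb₀ : ‖b i₀‖ = 1 := by
      rw [← hb, hN]
      exact congrArg NNReal.toReal hsup.symm
    -- Flipping all signs except at a maximal coefficient keeps the norm, and the two vectors add up
    -- to `2 b i₀ • y i₀`. The lower bound is thus `2(1 - δ/3)Θ - (1 + δ/3)Θ = (1 - δ)Θ`, whence the
    -- `δ / 3`.
    let b' : ℕ → 𝕜 := fun i => if i = i₀ then b i else -b i
    have hb' : N E b' = 1 := by
      rw [← hb, hN]
      refine congrArg NNReal.toReal (Finset.sup_congr rfl fun i _ => ?_)
      by_cases h : i = i₀ <;> simp [b', h]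
    have hsum : ∑ i ∈ E, b i • y i + ∑ i ∈ E, b' i • y i = (2 * b i₀) • y i₀ := by
      rw [← Finset.sum_add_distrib, Finset.sum_eq_single_of_mem i₀ hi₀]
      · simp only [b', if_true]
        module
      · intro i _ hi
        simp [b', hi]
    have h1 : q ((2 * b i₀) • y i₀) = 2 * q (y i₀) := by
      rw [map_smul_eq_mul, norm_mul, hb₀, RCLike.norm_ofNat, mul_one]
    have h2 := map_add_le_add q (∑ i ∈ E, b i • y i) (∑ i ∈ E, b' i • y i)
    rw [hsum, h1] at h2
    have h3 := hR E hE b' hb'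
    have h4 := hP i₀
    nlinarith
  · nlinarith

end Stabilization

/-! ### Passing to block sequences of the basis -/

section Block

variable {𝕜 : Type*} [RCLike 𝕜] {X : Type*} [NormedAddCommGroup X] [NormedSpace 𝕜 X]
  {N : Finset ℕ → (ℕ → 𝕜) → ℝ} {𝓕 : ℕ → Set (Finset ℕ)} {𝒮 : Set (Finset ℕ)}
  {e : SchauderBasis 𝕜 X}

open Filter Topology

/-- The vectors `x n` are finitely and successively supported. -/
def IsBlockSequence (e : SchauderBasis 𝕜 X) (x : ℕ → X) : Prop :=
  (∀ n, (basisSupport e (x n)).Finite) ∧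
    ∀ m n, m < n → ∀ i ∈ basisSupport e (x m), ∀ j ∈ basisSupport e (x n), i < j

theorem exists_of_mem_basisSupport_sum {F : Finset ℕ} {a : ℕ → 𝕜} {x : ℕ → X} {i : ℕ}
    (hi : i ∈ basisSupport e (∑ j ∈ F, a j • x j)) : ∃ j ∈ F, i ∈ basisSupport e (x j) := by
  by_contra! h
  refine hi ?_
  rw [map_sum]
  refine Finset.sum_eq_zero fun j hj => ?_
  have : e.coord i (x j) = 0 := not_not.1 (h j hj)
  rw [map_smul, this, smul_zero]

theorem IsBlockSequence.of_isBlocking {x y : ℕ → X} (hx : IsBlockSequence e x)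
    (hxy : IsBlocking N 𝒮 x y) : IsBlockSequence e y := by
  obtain ⟨F, a, hs, -, hy, -⟩ := hxy
  refine ⟨fun n => ?_, fun m n hmn i hi j hj => ?_⟩
  · refine ((F n).finite_toSet.biUnion fun k _ => hx.1 k).subset fun i hi => ?_
    rw [hy] at hi
    obtain ⟨k, hk, hik⟩ := exists_of_mem_basisSupport_sum hi
    exact Set.mem_biUnion (Finset.mem_coe.2 hk) hik
  · rw [hy] at hi hj
    obtain ⟨k, hk, hik⟩ := exists_of_mem_basisSupport_sum hi
    obtain ⟨l, hl, hjl⟩ := exists_of_mem_basisSupport_sum hj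
    exact hx.2 k l ((hs {m, n}).2 m (by simp) n (by simp) hmn k hk l hl) i hik j hjl

theorem coord_proj (n i : ℕ) (v : X) :
    e.coord i (e.proj n v) = if i < n then e.coord i v else 0 := by
  rw [SchauderBasis.proj_apply, map_sum]
  simp [e.ortho, Pi.single_apply]

/-- Every bounded sequence has a pair of far out terms whose first `m` coordinates almost agree. -/
theorem exists_pair_coord_sub_lt {x : ℕ → X} {C : ℝ} (hx : ∀ i, ‖x i‖ ≤ C) (e : SchauderBasis 𝕜 X)
    (m M : ℕ) {η : ℝ} (hη : 0 < η) :
    ∃ i j, M ≤ i ∧ i < j ∧ ∀ k < m, ‖e.coord k (x i - x j)‖ ≤ η := by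
  let T : X →L[𝕜] (Fin m → 𝕜) := ContinuousLinearMap.pi fun k => e.coord k
  have hb : Bornology.IsBounded (Set.range fun i => T (x i)) := by
    refine isBounded_iff_forall_norm_le.2 ⟨‖T‖ * C, ?_⟩
    rintro _ ⟨i, rfl⟩
    exact T.le_opNorm_of_le (hx i)
  obtain ⟨l, -, f, hf, hl⟩ := tendsto_subseq_of_bounded hb fun i => Set.mem_range_self i
  obtain ⟨n, hn⟩ := Metric.cauchySeq_iff.1 hl.cauchySeq η hη
  refine ⟨f (max n M), f (max n M + 1), (le_max_right _ _).trans hf.le_apply, hf (by omega),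
    fun k hk => ?_⟩
  have h := (hn (max n M) (le_max_left _ _) (max n M + 1) (by omega)).le
  rw [dist_eq_norm] at h
  simp only [Function.comp_apply, ← map_sub] at h
  exact (norm_le_pi_norm _ (⟨k, hk⟩ : Fin m)).trans h

/-- Blocks are normalized differences of two far out terms with almost equal initial coordinates.
The coefficients `1, -1` have `N`-norm at least one, so normalizing does not enlarge coordinates. -/
theorem exists_isBlocking_coord_tendsto (hN : IsGauge N) (h𝓕 : IsBlockClosed 𝓕 𝒮) {x : ℕ → X}
    {C : ℝ} (hx : ∀ i, ‖x i‖ ≤ C) (e : SchauderBasis 𝕜 X) :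
    ∃ y, IsBlocking N 𝒮 x y ∧ ∀ k, Tendsto (fun i => e.coord k (y i)) atTop (𝓝 0) := by
  obtain ⟨n, M₀, hpair⟩ := h𝓕.pair_mem
  obtain ⟨y, hxy, hP, -⟩ := h𝓕.exists_isBlocking hN (x := x)
    (P := fun i v => ∀ k < i, ‖e.coord k v‖ ≤ 1 / ((i : ℝ) + 1)) (R := fun _ => True) (n := n)
    (fun m M => by
      obtain ⟨i, j, hi, hij, h⟩ := exists_pair_coord_sub_lt hx e m (max M M₀)
        (show (0 : ℝ) < 1 / ((m : ℝ) + 1) by positivity)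
      have hle : ∀ p ∈ ({i, j} : Finset ℕ), max M M₀ ≤ p := by
        intro p hp
        rw [Finset.mem_insert, Finset.mem_singleton] at hp
        omega
      let a₀ : ℕ → 𝕜 := fun p => if p = i then 1 else -1
      have h1 : 1 ≤ N {i, j} a₀ := by
        simpa [a₀] using hN.le {i, j} a₀ i (by simp)
      have hn : ‖((N {i, j} a₀ : ℝ) : 𝕜)⁻¹‖ = (N {i, j} a₀)⁻¹ := by
        rw [norm_inv, RCLike.norm_ofReal, abs_of_pos (zero_lt_one.trans_le h1)]
      refine ⟨{i, j}, hpair _ Finset.card_le_two fun p hp => (le_max_right _ _).trans (hle p hp),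
        fun p hp => (le_max_left _ _).trans (hle p hp),
        fun p => ((N {i, j} a₀ : ℝ) : 𝕜)⁻¹ * a₀ p, ?_, fun k hk => ?_⟩
      · rw [hN.smul, hn, inv_mul_cancel₀ (zero_lt_one.trans_le h1).ne']
      · have hsum : ∑ p ∈ {i, j}, (((N {i, j} a₀ : ℝ) : 𝕜)⁻¹ * a₀ p) • x p =
            ((N {i, j} a₀ : ℝ) : 𝕜)⁻¹ • (x i - x j) := by
          rw [Finset.sum_pair hij.ne]
          simp only [a₀, if_true, if_neg hij.ne']
          module
        rw [hsum, map_smul, norm_smul, hn]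
        exact (mul_le_of_le_one_left (norm_nonneg _) (inv_le_one_of_one_le₀ h1)).trans (h k hk))
    (fun k => ⟨0, fun _ _ _ _ _ => trivial⟩)
  refine ⟨y, hxy, fun k => squeeze_zero_norm' ?_ tendsto_one_div_add_atTop_nhds_zero_nat⟩
  filter_upwards [eventually_gt_atTop k] with i hi using hP i k hi

/-- The gliding hump argument. -/
theorem exists_isBlockSequence_near {y : ℕ → X}
    (hy : ∀ k, Tendsto (fun i => e.coord k (y i)) atTop (𝓝 0)) {η : ℕ → ℝ} (hη : ∀ i, 0 < η i) :
    ∃ f : ℕ → ℕ, StrictMono f ∧ ∃ w, IsBlockSequence e w ∧ ∀ i, ‖y (f i) - w i‖ ≤ η i := by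
  have hproj : ∀ m, Tendsto (fun i => e.proj m (y i)) atTop (𝓝 0) := by
    intro m
    simp only [SchauderBasis.proj_apply]
    have := tendsto_finsetSum (Finset.range m) fun k _ => (hy k).smul_const (e k)
    simpa using this
  -- A state records the last index used and the last cut of the basis; the next vector is truncated
  -- to the coordinates between consecutive cuts.
  have step : ∀ (n : ℕ) (s : ℕ × ℕ), ∃ t : ℕ × ℕ, s.1 < t.1 ∧ s.2 ≤ t.2 ∧
      ‖y t.1 - (e.proj t.2 (y t.1) - e.proj s.2 (y t.1))‖ ≤ η n := by
    rintro n ⟨i₀, m⟩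
    obtain ⟨i, hi, hi₀⟩ := (((hproj m).norm.eventually_lt_const
      (show ‖(0 : X)‖ < η n / 2 by simpa using half_pos (hη n))).and
      (eventually_gt_atTop i₀)).exists
    obtain ⟨m', hm', hmm⟩ := ((Metric.tendsto_nhds.1 (e.tendsto_proj (y i)) (η n / 2)
      (half_pos (hη n))).and (eventually_ge_atTop m)).exists
    refine ⟨(i, m'), hi₀, hmm, ?_⟩
    rw [dist_comm, dist_eq_norm] at hm'
    calc ‖y i - (e.proj m' (y i) - e.proj m (y i))‖
        = ‖(y i - e.proj m' (y i)) + e.proj m (y i)‖ := by congr 1; abel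
      _ ≤ ‖y i - e.proj m' (y i)‖ + ‖e.proj m (y i)‖ := norm_add_le _ _
      _ ≤ η n := by linarith
  choose t ht1 ht2 ht3 using step
  let s : ℕ → ℕ × ℕ := fun n => Nat.rec (0, 0) (fun n s => t n s) n
  have hs2 : Monotone fun n => (s n).2 := monotone_nat_of_le_succ fun n => ht2 n (s n)
  have hsupp : ∀ n, ∀ i ∈ basisSupport e (e.proj (s (n + 1)).2 (y (s (n + 1)).1) -
      e.proj (s n).2 (y (s (n + 1)).1)), (s n).2 ≤ i ∧ i < (s (n + 1)).2 := by
    intro n i hi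
    have h12 : (s n).2 ≤ (s (n + 1)).2 := hs2 n.le_succ
    by_contra h
    refine hi ?_
    rw [map_sub, coord_proj, coord_proj]
    by_cases h1 : i < (s n).2
    · rw [if_pos h1, if_pos (h1.trans_le h12), sub_self]
    · rw [if_neg h1, if_neg (fun h2 => h ⟨not_lt.1 h1, h2⟩), sub_self]
  refine ⟨fun n => (s (n + 1)).1, strictMono_nat_of_lt_succ fun n => ht1 (n + 1) (s (n + 1)),
    fun n => e.proj (s (n + 1)).2 (y (s (n + 1)).1) - e.proj (s n).2 (y (s (n + 1)).1),
    ⟨fun n => ?_, fun m n hmn i hi j hj => ?_⟩, fun n => ht3 n (s n)⟩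
  · exact (Set.finite_Iio (s (n + 1)).2).subset fun i hi => (hsupp n i hi).2
  · exact (hsupp m i hi).2.trans_le ((hs2 hmn).trans (hsupp n j hj).1)

/-- Each coefficient is at most `N E a`, so the errors add up to at most `N E a` times the geometric
sum `2 * η`. -/
theorem IsEstimate.perturb (hN : IsGauge N) {y w : ℕ → X} {c C η : ℝ}
    (hy : IsEstimate N 𝒮 (normSeminorm 𝕜 X) y c C)
    (hw : ∀ i, ‖y i - w i‖ ≤ η * (1 / 2) ^ i) :
    IsEstimate N 𝒮 (normSeminorm 𝕜 X) w (c - 2 * η) (C + 2 * η) := by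
  intro E hE a
  have hη : 0 ≤ η := by simpa using (norm_nonneg _).trans (hw 0)
  have hdiff : ‖∑ i ∈ E, a i • y i - ∑ i ∈ E, a i • w i‖ ≤ 2 * η * N E a := by
    rw [← Finset.sum_sub_distrib]
    calc ‖∑ i ∈ E, (a i • y i - a i • w i)‖ ≤ ∑ i ∈ E, N E a * (η * (1 / 2) ^ i) := by
          refine norm_sum_le_of_le _ fun i hi => ?_
          rw [← smul_sub, norm_smul]
          exact mul_le_mul (hN.le E a i hi) (hw i) (norm_nonneg _) (hN.nonneg E a)
      _ = N E a * η * ∑ i ∈ E, (1 / 2 : ℝ) ^ i := by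
          rw [Finset.mul_sum]
          exact Finset.sum_congr rfl fun i _ => by ring
      _ ≤ N E a * η * 2 := by
          refine mul_le_mul_of_nonneg_left ?_ (mul_nonneg (hN.nonneg E a) hη)
          exact (summable_geometric_two.sum_le_tsum E fun i _ => by positivity).trans_eq
            tsum_geometric_two
      _ = 2 * η * N E a := by ring
  obtain ⟨h1, h2⟩ := hy E hE a
  simp only [coe_normSeminorm] at h1 h2 ⊢
  have h3 := norm_sub_norm_le (∑ i ∈ E, a i • y i) (∑ i ∈ E, a i • w i)
  have h4 := norm_sub_norm_le (∑ i ∈ E, a i • w i) (∑ i ∈ E, a i • y i)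
  rw [norm_sub_rev] at h4
  constructor <;> linarith

theorem exists_isBlockSequence_isEstimate (hN : IsGauge N) (h𝓕 : IsBlockClosed 𝓕 𝒮) {x : ℕ → X}
    {c C : ℝ} (hc : 0 < c) (hx : IsEstimate N 𝒮 (normSeminorm 𝕜 X) x c C)
    (e : SchauderBasis 𝕜 X) :
    ∃ w, IsBlockSequence e w ∧ ∃ c' C', 0 < c' ∧ IsEstimate N 𝒮 (normSeminorm 𝕜 X) w c' C' := by
  have hbdd : ∀ i, ‖x i‖ ≤ C := fun i => by
    simpa [hN.single] using (hx {i} (h𝓕.singleton_mem i) fun _ => 1).2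
  obtain ⟨y, hxy, hy⟩ := exists_isBlocking_coord_tendsto hN h𝓕 hbdd e
  -- The factor `c / 4` leaves the positive lower constant `c / 2` after perturbation.
  obtain ⟨f, hf, w, hw, hyw⟩ := exists_isBlockSequence_near hy
    (η := fun i => c / 4 * (1 / 2) ^ i) fun i => by positivity
  exact ⟨w, hw, c - 2 * (c / 4), C + 2 * (c / 4), by linarith,
    ((isBlocking_comp hN h𝓕 hf).isEstimate hN (hxy.isEstimate hN hx)).perturb hN hyw⟩

end Block

/-! ### Non-distortability -/

section Distortion

variable {𝕜 : Type*} [RCLike 𝕜] {X : Type*} [NormedAddCommGroup X] [NormedSpace 𝕜 X]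
  {N : Finset ℕ → (ℕ → 𝕜) → ℝ} {𝓕 : ℕ → Set (Finset ℕ)} {𝒮 : Set (Finset ℕ)}
  {e : SchauderBasis 𝕜 X}

theorem exists_isNormalizedBlockSequence_le (hN : IsGauge N) (h𝓕 : IsBlockClosed 𝓕 𝒮)
    (hstab : ∀ (x : ℕ → X) (q : Seminorm 𝕜 X) (c C δ : ℝ), 0 < c → IsEstimate N 𝒮 q x c C →
      0 < δ → ∃ y Θ, 0 < Θ ∧ IsBlocking N 𝒮 x y ∧
        IsEstimate N 𝒮 q y ((1 - δ) * Θ) ((1 + δ) * Θ))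
    {x : ℕ → X} {c C : ℝ} (hc : 0 < c) (hx : IsEstimate N 𝒮 (normSeminorm 𝕜 X) x c C)
    (e : SchauderBasis 𝕜 X) {p : Seminorm 𝕜 X} (hp : IsEquivalentNorm p) {ε : ℝ} (hε : 0 < ε) :
    ∃ z, IsNormalizedBlockSequence e z ∧ ∀ E ∈ 𝒮, ∀ u ∈ Submodule.span 𝕜 (z '' (E : Set ℕ)),
      ∀ v ∈ Submodule.span 𝕜 (z '' (E : Set ℕ)), ‖u‖ = 1 → ‖v‖ = 1 → p u ≤ (1 + ε) * p v := by
  -- Two stabilizations each cost a factor `(1 + δ) / (1 - δ)` in the ratio of `p u` to `p v`.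
  obtain ⟨δ, hδ, hδ1, hδε⟩ : ∃ δ : ℝ, 0 < δ ∧ δ < 1 ∧ (1 + δ) ^ 2 ≤ (1 + ε) * (1 - δ) ^ 2 := by
    have h0 : 0 < min ε 1 := lt_min hε one_pos
    have h1 : min ε 1 ≤ 1 := min_le_right _ _
    refine ⟨min ε 1 / 8, by linarith, by linarith, ?_⟩
    calc (1 + min ε 1 / 8) ^ 2 ≤ (1 + min ε 1) * (1 - min ε 1 / 8) ^ 2 := by
          nlinarith [mul_pos h0 h0, mul_pos (mul_pos h0 h0) h0]
      _ ≤ (1 + ε) * (1 - min ε 1 / 8) ^ 2 := by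
          gcongr; exact min_le_left _ _
  obtain ⟨w, hw, c₁, C₁, hc₁, hwE⟩ := exists_isBlockSequence_isEstimate hN h𝓕 hc hx e
  obtain ⟨w', Θ₁, hΘ₁, hww', hw'E⟩ := hstab w _ c₁ C₁ δ hc₁ hwE hδ
  obtain ⟨α, β, hα, hβ, hpe⟩ := hp
  have hw'p : IsEstimate N 𝒮 p w' (α * c₁) (β * C₁) := by
    intro E hE a
    obtain ⟨h1, h2⟩ := hww'.isEstimate hN hwE E hE a
    obtain ⟨h3, h4⟩ := hpe (∑ i ∈ E, a i • w' i)
    rw [mul_assoc, mul_assoc]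
    exact ⟨(mul_le_mul_of_nonneg_left h1 hα.le).trans h3,
      h4.trans (mul_le_mul_of_nonneg_left h2 hβ.le)⟩
  -- Stabilizing `p` does not spoil the estimate for the norm, since estimates pass to blockings
  -- with the same constants.
  obtain ⟨z, Θ₂, hΘ₂, hwz, hzp⟩ := hstab w' p _ _ δ (mul_pos hα hc₁) hw'p hδ
  have hzE := hwz.isEstimate hN hw'E
  have hz := (hw.of_isBlocking hww').of_isBlocking hwz
  have hz0 : ∀ i, 0 < ‖z i‖ := fun i => by
    have := (hzE {i} (h𝓕.singleton_mem i) fun _ => 1).1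
    simp only [hN.single, norm_one, mul_one, Finset.sum_singleton, one_smul,
      coe_normSeminorm] at this
    exact lt_of_lt_of_le (mul_pos (by linarith) hΘ₁) this
  have hsupp : ∀ i, basisSupport e (((‖z i‖ : ℝ) : 𝕜)⁻¹ • z i) ⊆ basisSupport e (z i) := by
    intro i k hk h0
    exact hk (by rw [map_smul, h0, smul_zero])
  refine ⟨fun i => ((‖z i‖ : ℝ) : 𝕜)⁻¹ • z i, ⟨fun i => ?_, fun i => (hz.1 i).subset (hsupp i),
    fun n i hi j hj => hz.2 n (n + 1) n.lt_succ_self i (hsupp _ hi) j (hsupp _ hj)⟩, ?_⟩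
  · rw [norm_smul, norm_inv, RCLike.norm_ofReal, abs_norm, inv_mul_cancel₀ (hz0 i).ne']
  have hspan : ∀ E : Finset ℕ, ∀ u ∈ Submodule.span 𝕜
      ((fun i => ((‖z i‖ : ℝ) : 𝕜)⁻¹ • z i) '' (E : Set ℕ)),
      ∃ b : ℕ → 𝕜, u = ∑ i ∈ E, b i • z i := by
    intro E u hu
    obtain ⟨b, rfl⟩ := (Submodule.mem_span_image_finset_iff_exists_fun' 𝕜).1 hu
    exact ⟨fun i => b i * ((‖z i‖ : ℝ) : 𝕜)⁻¹,
      Finset.sum_congr rfl fun i _ => by rw [smul_smul]⟩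
  intro E hE u hu v hv hu1 hv1
  obtain ⟨a, rfl⟩ := hspan E u hu
  obtain ⟨b, rfl⟩ := hspan E v hv
  have h1 := (hzE E hE a).1
  have h2 := (hzE E hE b).2
  rw [coe_normSeminorm, hu1] at h1
  rw [coe_normSeminorm, hv1] at h2
  have h3 := (hzp E hE a).2
  have h4 := (hzp E hE b).1
  set U := p (∑ i ∈ E, a i • z i)
  set V := p (∑ i ∈ E, b i • z i)
  have hδ' : 0 < 1 - δ := by linarith
  have h5 : U * ((1 - δ) * Θ₁) ≤ (1 + δ) * Θ₂ := by
    calc U * ((1 - δ) * Θ₁) ≤ (1 + δ) * Θ₂ * N E a * ((1 - δ) * Θ₁) := by gcongr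
      _ = (1 + δ) * Θ₂ * ((1 - δ) * Θ₁ * N E a) := by ring
      _ ≤ (1 + δ) * Θ₂ * 1 := by gcongr
      _ = _ := mul_one _
  have h6 : (1 - δ) * Θ₂ ≤ V * ((1 + δ) * Θ₁) := by
    calc (1 - δ) * Θ₂ = (1 - δ) * Θ₂ * 1 := (mul_one _).symm
      _ ≤ (1 - δ) * Θ₂ * ((1 + δ) * Θ₁ * N E b) := by gcongr
      _ = (1 - δ) * Θ₂ * N E b * ((1 + δ) * Θ₁) := by ring
      _ ≤ V * ((1 + δ) * Θ₁) := by gcongr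
  have hV : 0 ≤ V := apply_nonneg p _
  have h7 : U * ((1 - δ) ^ 2 * Θ₁) ≤ (1 + ε) * V * ((1 - δ) ^ 2 * Θ₁) := by
    calc U * ((1 - δ) ^ 2 * Θ₁) = U * ((1 - δ) * Θ₁) * (1 - δ) := by ring
      _ ≤ (1 + δ) * Θ₂ * (1 - δ) := by gcongr
      _ = (1 + δ) * ((1 - δ) * Θ₂) := by ring
      _ ≤ (1 + δ) * (V * ((1 + δ) * Θ₁)) := by gcongr
      _ = (1 + δ) ^ 2 * (V * Θ₁) := by ring
      _ ≤ (1 + ε) * (1 - δ) ^ 2 * (V * Θ₁) := by gcongr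
      _ = _ := by ring
  exact le_of_mul_le_mul_right h7 (by positivity)

theorem not_isDistortable_of_isEstimate (hN : IsGauge N) (h𝓕 : IsBlockClosed 𝓕 𝒮)
    (hstab : ∀ (x : ℕ → X) (q : Seminorm 𝕜 X) (c C δ : ℝ), 0 < c → IsEstimate N 𝒮 q x c C →
      0 < δ → ∃ y Θ, 0 < Θ ∧ IsBlocking N 𝒮 x y ∧
        IsEstimate N 𝒮 q y ((1 - δ) * Θ) ((1 + δ) * Θ))
    {x : ℕ → X} {c C : ℝ} (hc : 0 < c) (hx : IsEstimate N 𝒮 (normSeminorm 𝕜 X) x c C)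
    {𝒯 : Set (Finset ℕ)} {r : ℕ} (h𝒯 : ∀ E ∈ 𝒯, E.image (· + r) ∈ 𝒮)
    (e : SchauderBasis 𝕜 X) {ε : ℝ} (hε : 0 < ε) :
    ¬ IsDistortable e (1 + ε) 𝒯 := by
  rintro ⟨p, hp, hdist⟩
  obtain ⟨z, ⟨hz1, hz2, hz3⟩, hz⟩ :=
    exists_isNormalizedBlockSequence_le hN h𝓕 hstab hc hx e hp hε
  -- Testing the distortion on the tail of `z` turns `E ∈ 𝒯` into the index set `E + r`, which lies
  -- in `𝒮`.
  obtain ⟨E, hE, u, hu, v, hv, hu1, hv1, huv⟩ := hdist (fun n => z (n + r))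
    ⟨fun n => hz1 _, fun n => hz2 _, fun n => by
      have := hz3 (n + r)
      rwa [add_right_comm] at this⟩
  have himage : (fun n => z (n + r)) '' (E : Set ℕ) =
      z '' ((E.image (· + r) : Finset ℕ) : Set ℕ) := by
    rw [Finset.coe_image, Set.image_image]
  rw [himage] at hu hv
  have hle := hz _ (h𝒯 E hE) u hu v hv hu1 hv1
  obtain ⟨α, _, hα, -, hpe⟩ := hp
  have hpv : 0 < p v := by
    have := (hpe v).1
    rw [hv1, mul_one] at this
    exact hα.trans_le this
  rw [lt_div_iff₀ hpv] at huv
  exact absurd hle huv.not_ge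

end Distortion

theorem proposition3 {𝕜 : Type*} [RCLike 𝕜] {X : Type*} [NormedAddCommGroup X]
    [NormedSpace 𝕜 X] [CompleteSpace X] (e : SchauderBasis 𝕜 X)
    (φ : Ordinal.{0} → ℕ → Ordinal.{0}) (hφ : IsLadder φ)
    (ξ : Ordinal.{0}) (hξ : ξ < Ordinal.omega 1)
    (hX : ContainsEllOneSpreadingModel 𝕜 X (schreier φ (Ordinal.omega0 ^ ξ)) ∨
      ContainsCZeroSpreadingModel 𝕜 X (schreier φ (Ordinal.omega0 ^ ξ)))
    (ε : ℝ) (hε : 0 < ε) :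
    Ordinal.omega0 ^ ξ < distortionIndex φ e (1 + ε) := by
  have hω := omega0_opow_lt_omega1 hξ
  obtain ⟨𝓕, h𝓕⟩ := exists_isBlockClosed_schreier hφ hξ
  have key : ∀ η ≤ ω ^ ξ, ¬ IsDistortable e (1 + ε) (schreier φ η) := by
    intro η hη
    obtain ⟨r, hr⟩ := schreier_eventually_subset hφ hω hη
    have h𝒯 : ∀ E ∈ schreier φ η, E.image (· + r) ∈ schreier φ (ω ^ ξ) := fun E hE =>
      hr _ (schreier_image hφ (hη.trans_lt hω) (add_left_strictMono (a := r)) E hE)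
        (by simp)
    rcases hX with ⟨-, -, x, -, c, C, hc, -, -, hx⟩ | ⟨-, -, x, -, c, C, hc, -, -, hx⟩
    · exact not_isDistortable_of_isEstimate isGauge_ellOne h𝓕
        (fun x q c C δ hc hx hδ => exists_isBlocking_isEstimate_ellOne rfl h𝓕 hc hx hδ)
        (inv_pos.2 hc) (fun E hE a => hx E hE a) h𝒯 e hε
    · exact not_isDistortable_of_isEstimate isGauge_cZero h𝓕
        (fun x q c C δ hc hx hδ => exists_isBlocking_isEstimate_cZero rfl h𝓕 hc hx hδ)
        (inv_pos.2 hc) (fun E hE a => hx E hE a) h𝒯 e hε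
  unfold distortionIndex
  split_ifs with h
  -- The infimum of a nonempty set of ordinals belongs to it, so an index at most `ω ^ ξ` would
  -- contradict `key`.
  · by_contra hle
    exact key _ (not_lt.1 hle) (csInf_mem h).2
  · exact hω
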